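/- Let $\mathbb{T}$ and $\mathbb{D}$ denote the unit circle and the open unit disk in $\mathbb{C}$. Let $\mu$ be a finite positive Borel measure on $\mathbb{T}$ whose support is an infinite set, let $\langle P,Q\rangle=\int_{\mathbb{T}} P\,\overline{Q}\,d\mu$, and let $\rho_k$ be the monic orthogonal polynomial of degree $k$ for this inner product. For a polynomial $P(z)=\sum_{j=0}^k p_jz^j$, regarded as a polynomial of degree at most $k$, put $P^*(z)=z^k\,\overline{P(1/\overline z)}=\sum_{j=0}^k\overline{p_{k-j}}\,z^j$ (for $\rho_k$ take this $k$), and let $F_k(z)=z\rho_{k-1}(z)/\rho_{k-1}^*(z)$ for $k\ge 1$. For $n\ge 3$, an $(n,3)$-QPOPUC is a polynomial $Q$ of degree exactly $n$ such that $Q=\tau Q^*$ for some $\tau\in\mathbb{T}$ (with $Q^*(z)=z^n\overline{Q(1/\overline z)}$) and $\langle Q,z^k\rangle=0$ for all integers $k$ with $2\le k\le n-2$ (no condition if $n=3$). For distinct $a,c,b\in\mathbb{T}$, the orientation of $\mathrm{arc}(a,c,b)$, the arc from $a$ over $c$ to $b$, is counterclockwise if, going counterclockwise from $a$, one meets $c$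 before $b$, and clockwise otherwise. **Theorem.** Let $n\ge 3$, let $\alpha_1,\alpha_2,\alpha_3\in\mathbb{T}$ be distinct, and suppose that the points $f_i=\overline{F_{n-1}(\alpha_i)}$, $i=1,2,3$, are distinct. If $\mathrm{arc}(\alpha_1,\alpha_2,\alpha_3)$ and $\mathrm{arc}(f_1,f_2,f_3)$ have the same orientation, then there exists a unique monic $(n,3)$-QPOPUC $Q$ all of whose zeros are simple and lie on $\mathbb{T}$ and which vanishes at $\alpha_1,\alpha_2,\alpha_3$. Moreover, $$Q(z)=z(z-\eta)\rho_{n-2}(z)+\tau(1-\overline{\eta}z)\rho_{n-2}^*(z)$$ for exactly one pair $(\eta,\tau)\in\mathbb{C}\times\mathbb{T}$, and this pair satisfies $\eta\in\mathbb{D}$. -/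

import Mathlib

namespace OPUC

open MeasureTheory Polynomial

noncomputable section

/-- The inner product `⟨P, Q⟩ = ∫ P(z) conj(Q(z)) dμ(z)` on polynomials induced by a measure carried by
the unit circle. -/
def ip (μ : Measure ℂ) (P Q : ℂ[X]) : ℂ :=
  ∫ z, P.eval z * (starRingEnd ℂ) (Q.eval z) ∂μ

/-- The monic orthogonal polynomial `ρ_n` of degree `n` in `L²(μ)`, obtained by applying the
Gram–Schmidt process (without normalization) to `1, z, z², …`. -/
def rho (μ : Measure ℂ) (n : ℕ) : ℂ[X] :=
  X ^ n - ∑ k : Fin n, C (ip μ (X ^ n) (rho μ k) / ip μ (rho μ k) (rho μ k)) * rho μ k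
termination_by n
decreasing_by exact k.2

/-- The reciprocal polynomial `P^*(z) = z^n conj(P(1 / conj z))` of a polynomial `P` of degree at
most `n`: if `P = ∑_{k ≤ n} p_k z^k` then `P^* = ∑_{k ≤ n} conj(p_{n-k}) z^k`. -/
def recip (n : ℕ) (P : ℂ[X]) : ℂ[X] :=
  (P.map (starRingEnd ℂ)).reflect n

/-- The Blaschke product `F_n(z) = z ρ_{n-1}(z) / ρ_{n-1}^*(z)`, for `n ≥ 1`. -/
def blaschke (μ : Measure ℂ) (n : ℕ) (z : ℂ) : ℂ :=
  z * (rho μ (n - 1)).eval z / (recip (n - 1) (rho μ (n - 1))).eval z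

/-- A polynomial `P` of degree exactly `n` is invariant if `P = τ P^*` for some `τ` on the unit
circle. -/
def IsInvariant (n : ℕ) (P : ℂ[X]) : Prop :=
  P.degree = (n : WithBot ℕ) ∧ ∃ τ : ℂ, ‖τ‖ = 1 ∧ P = C τ * recip n P

/-- `Q` is an `(n, 2ℓ+1)`-QPOPUC (quasi-paraorthogonal polynomial on the unit circle of degree `n`
and order `2ℓ+1`): an invariant polynomial of degree `n` that is orthogonal to
`span {z^k : ℓ+1 ≤ k ≤ n-ℓ-1}`. -/
def IsQPOPUC (μ : Measure ℂ) (n ℓ : ℕ) (Q : ℂ[X]) : Prop :=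
  IsInvariant n Q ∧ ∀ k : ℕ, ℓ + 1 ≤ k → k + ℓ + 1 ≤ n → ip μ Q (X ^ k) = 0

/-- The polynomial `z (z - η) ρ_{n-2}(z) + τ (1 - conj(η) z) ρ_{n-2}^*(z)`, for `n ≥ 2`. -/
def q3 (μ : Measure ℂ) (n : ℕ) (η τ : ℂ) : ℂ[X] :=
  X * (X - C η) * rho μ (n - 2) +
    C τ * (1 - C ((starRingEnd ℂ) η) * X) * recip (n - 2) (rho μ (n - 2))

/-- All zeros of `Q` are simple and lie on the unit circle. -/
def SimpleZerosOnCircle (Q : ℂ[X]) : Prop :=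
  ∀ z : ℂ, Q.IsRoot z → ‖z‖ = 1 ∧ Q.rootMultiplicity z = 1

/-- `arc(a, c, b)` is a counterclockwise arc of the unit circle: going counterclockwise from `a`,
one meets `c` before `b`, within one turn. -/
def IsCounterclockwise (a c b : ℂ) : Prop :=
  ∃ r s t : ℝ, r < s ∧ s < t ∧ t < r + 2 * Real.pi ∧
    a = Complex.exp (r * Complex.I) ∧ c = Complex.exp (s * Complex.I) ∧
    b = Complex.exp (t * Complex.I)

/-- `arc(a, c, b)` is a clockwise arc of the unit circle: the same arc traversed backwards, from
`b` over `c` to `a`, is counterclockwise. -/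
def IsClockwise (a c b : ℂ) : Prop := IsCounterclockwise b c a

/-- `arc(a, c, b)` and `arc(a', c', b')` have the same orientation. -/
def SameOrientation (a c b a' c' b' : ℂ) : Prop :=
  (IsCounterclockwise a c b ∧ IsCounterclockwise a' c' b') ∨
    (IsClockwise a c b ∧ IsClockwise a' c' b')

end

end OPUC

namespace OPUC

open MeasureTheory Polynomial ComplexConjugate

/-! The polynomial `q3 μ n η τ` is `P + τ P^*` with `P = z (z - η) ρ_{n-2}`. On the circle it
factors as `ρ_{n-2}^* F_{n-1}` times `(z - η) + τ (1 - conj η z) conj(F_{n-1}(z))`, and the first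
two factors do not vanish there (`isRoot_q3_iff`). Vanishing at the `α_i` thus says that a Möbius
map of the circle sends `α_i` to `f_i`.

In homogeneous form `p α + q = f (conj q α + conj p)` these are three real linear equations in four
real unknowns, so a nonzero solution exists (`exists_moebius_interpolation`). The signed areas of
the two triangles are related by a nonnegative factor and the cube of `|p|² - |q|²`; equal
orientation forces `|q| < |p|` (`norm_lt_norm_of_signedArea`). Normalizing by `p` gives `η` in the
disc and `τ` on the circle. All zeros of `P` then lie in the open disc, and a Blaschke product
argument puts the zeros of `P + τ P^*` on the circle and makes them simple
(`simpleZerosOnCircle_add_recip`).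

For uniqueness, every monic QPOPUC of order 3 has the form `q3` (`exists_eq_q3`), and three
interpolation points determine the parameters (`moebius_parameters_unique`). -/

theorem mul_conj_of_norm_eq_one {z : ℂ} (hz : ‖z‖ = 1) : z * conj z = 1 := by
  rw [Complex.mul_conj, Complex.normSq_eq_norm_sq, hz]; simp

theorem ne_zero_of_norm_eq_one {z : ℂ} (hz : ‖z‖ = 1) : z ≠ 0 := by
  rintro rfl; simp at hz

/-! ### Reciprocal polynomials -/

theorem recip_add (n : ℕ) (P Q : ℂ[X]) : recip n (P + Q) = recip n P + recip n Q := by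
  simp [recip, reflect_add]

theorem recip_C_mul (n : ℕ) (c : ℂ) (P : ℂ[X]) : recip n (C c * P) = C (conj c) * recip n P := by
  simp [recip, reflect_C_mul]

theorem recip_mul {m n : ℕ} {P Q : ℂ[X]} (hP : P.natDegree ≤ m) (hQ : Q.natDegree ≤ n) :
    recip (m + n) (P * Q) = recip m P * recip n Q := by
  simp only [recip, Polynomial.map_mul]
  exact reflect_mul _ _ (natDegree_map_le.trans hP) (natDegree_map_le.trans hQ)

theorem recip_recip (n : ℕ) (P : ℂ[X]) : recip n (recip n P) = P := by
  simp [recip, reflect_map, Polynomial.map_map]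

theorem natDegree_recip_le {n : ℕ} {P : ℂ[X]} (hP : P.natDegree ≤ n) :
    (recip n P).natDegree ≤ n :=
  natDegree_reflect_le.trans (max_le le_rfl (natDegree_map_le.trans hP))

theorem coeff_zero_recip (n : ℕ) (P : ℂ[X]) : (recip n P).coeff 0 = conj (P.coeff n) := by
  simp [recip, coeff_reflect]

theorem recip_one_linear (a b : ℂ) :
    recip 1 (C a * X + C b) = C (conj b) * X + C (conj a) := by
  rw [recip_add, recip_C_mul]
  simp [recip, reflect_C, add_comm]

theorem recip_one_X_sub_C (w : ℂ) : recip 1 (X - C w) = 1 - C (conj w) * X := by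
  have := recip_one_linear 1 (-w)
  simp only [map_one, map_neg, one_mul, ← sub_eq_add_neg] at this
  rw [this]
  ring

theorem eval_recip {n : ℕ} {P : ℂ[X]} (hP : P.natDegree ≤ n) {z : ℂ} (hz : ‖z‖ = 1) :
    (recip n P).eval z = z ^ n * conj (P.eval z) := by
  have hz0 := ne_zero_of_norm_eq_one hz
  have hc := mul_conj_of_norm_eq_one hz
  have hi : conj z = z⁻¹ := eq_inv_of_mul_eq_one_right hc
  let _ : Invertible z⁻¹ := invertibleOfNonzero (inv_ne_zero hz0)
  have h := eval₂_reflect_mul_pow (RingHom.id ℂ) z⁻¹ n (P.map (starRingEnd ℂ))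
    (natDegree_map_le.trans hP)
  have h2 : eval₂ (RingHom.id ℂ) z⁻¹ (P.map (starRingEnd ℂ)) = conj (P.eval z) := by
    rw [← hi, eval₂_id, eval_map, eval₂_hom]
  rw [h2] at h
  simp only [invOf_eq_inv, inv_inv, eval₂_id] at h
  rw [← h, recip, mul_comm, mul_assoc, ← mul_pow, inv_mul_cancel₀ hz0, one_pow, mul_one]

/-! ### Zeros of `P + τ P^*` for `P` with all zeros in the open disc -/

theorem recip_prod_X_sub_C (s : Multiset ℂ) :
    recip (Multiset.card s) (s.map fun w => X - C w).prod =
      (s.map fun w => 1 - C (conj w) * X).prod := by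
  induction s using Multiset.induction_on with
  | empty => simp [recip]
  | cons w s ih =>
    rw [Multiset.map_cons, Multiset.prod_cons, Multiset.map_cons, Multiset.prod_cons,
      Multiset.card_cons, add_comm, recip_mul (by simp), ih, recip_one_X_sub_C]
    rw [natDegree_multiset_prod_X_sub_C_eq_card]

/-- The sign of the right side shows on which side of the circle a Blaschke factor has modulus below
or above 1. -/
theorem normSq_one_sub_conj_mul (w z : ℂ) :
    Complex.normSq (1 - conj w * z) - Complex.normSq (z - w) =
      (1 - Complex.normSq w) * (1 - Complex.normSq z) := by
  simp only [Complex.normSq_apply, Complex.sub_re, Complex.sub_im, Complex.mul_re, Complex.mul_im,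
    Complex.conj_re, Complex.conj_im, Complex.one_re, Complex.one_im]
  ring

theorem one_sub_conj_mul_ne_zero {w z : ℂ} (hw : ‖w‖ < 1) (hz : ‖z‖ ≤ 1) :
    1 - conj w * z ≠ 0 := by
  intro h
  have h1 : ‖conj w * z‖ = 1 := by rw [← sub_eq_zero.mp h]; simp
  rw [norm_mul, Complex.norm_conj] at h1
  nlinarith [norm_nonneg w, norm_nonneg z]

theorem normSq_lt_one_iff (w : ℂ) : Complex.normSq w < 1 ↔ ‖w‖ < 1 := by
  rw [Complex.normSq_eq_norm_sq, sq_lt_one_iff₀ (norm_nonneg w)]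

theorem norm_lt_norm_iff_normSq (a b : ℂ) :
    ‖a‖ < ‖b‖ ↔ Complex.normSq a < Complex.normSq b := by
  rw [Complex.normSq_eq_norm_sq, Complex.normSq_eq_norm_sq,
    sq_lt_sq₀ (norm_nonneg a) (norm_nonneg b)]

theorem norm_sub_lt_of_norm_lt_one {w z : ℂ} (hw : ‖w‖ < 1) (hz : ‖z‖ < 1) :
    ‖z - w‖ < ‖1 - conj w * z‖ := by
  rw [norm_lt_norm_iff_normSq, ← sub_pos, normSq_one_sub_conj_mul]
  exact mul_pos (sub_pos.2 ((normSq_lt_one_iff w).2 hw)) (sub_pos.2 ((normSq_lt_one_iff z).2 hz))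

theorem norm_lt_norm_sub_of_one_lt_norm {w z : ℂ} (hw : ‖w‖ < 1) (hz : 1 < ‖z‖) :
    ‖1 - conj w * z‖ < ‖z - w‖ := by
  rw [norm_lt_norm_iff_normSq, ← sub_neg, normSq_one_sub_conj_mul]
  refine mul_neg_of_pos_of_neg (sub_pos.2 ((normSq_lt_one_iff w).2 hw)) (sub_neg.2 ?_)
  rw [Complex.normSq_eq_norm_sq]
  nlinarith

theorem eval_recip_prod_ne_zero {s : Multiset ℂ} (hs : ∀ w ∈ s, ‖w‖ < 1) {z : ℂ} (hz : ‖z‖ ≤ 1) :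
    (s.map fun w => 1 - C (conj w) * X).prod.eval z ≠ 0 := by
  rw [eval_multiset_prod, Multiset.map_map]
  refine Multiset.prod_ne_zero ?_
  simp only [Multiset.mem_map, not_exists, not_and]
  intro w hw h
  exact one_sub_conj_mul_ne_zero (hs w hw) hz (by simpa using h)

theorem norm_eval_prod_le {s : Multiset ℂ} (hs : ∀ w ∈ s, ‖w‖ < 1) {z : ℂ} (hz : ‖z‖ < 1) :
    ‖(s.map fun w => X - C w).prod.eval z‖ ≤
      ‖(s.map fun w => 1 - C (conj w) * X).prod.eval z‖ := by
  induction s using Multiset.induction_on with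
  | empty => simp
  | cons w s ih =>
    simp only [Multiset.map_cons, Multiset.prod_cons, eval_mul, norm_mul]
    refine mul_le_mul ?_ (ih fun v hv => hs v (Multiset.mem_cons_of_mem hv)) (norm_nonneg _)
      (norm_nonneg _)
    simpa using (norm_sub_lt_of_norm_lt_one (hs w (Multiset.mem_cons_self w s)) hz).le

/-- One factor supplies strictness; the weak bound suffices for the others, whose product of
reciprocals is nonzero. -/
theorem norm_eval_prod_lt {s : Multiset ℂ} (hs : ∀ w ∈ s, ‖w‖ < 1) (h0 : s ≠ 0) {z : ℂ}
    (hz : ‖z‖ < 1) :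
    ‖(s.map fun w => X - C w).prod.eval z‖ <
      ‖(s.map fun w => 1 - C (conj w) * X).prod.eval z‖ := by
  obtain ⟨w, hw⟩ := Multiset.exists_mem_of_ne_zero h0
  obtain ⟨t, rfl⟩ := Multiset.exists_cons_of_mem hw
  have ht : ∀ v ∈ t, ‖v‖ < 1 := fun v hv => hs v (Multiset.mem_cons_of_mem hv)
  simp only [Multiset.map_cons, Multiset.prod_cons, eval_mul, norm_mul]
  refine mul_lt_mul_of_lt_of_le_of_nonneg_of_pos ?_ (norm_eval_prod_le ht hz) (norm_nonneg _)
    (norm_pos_iff.2 (eval_recip_prod_ne_zero ht hz.le))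
  simpa using norm_sub_lt_of_norm_lt_one (hs w hw) hz

theorem norm_eval_recip_prod_le {s : Multiset ℂ} (hs : ∀ w ∈ s, ‖w‖ < 1) {z : ℂ} (hz : 1 < ‖z‖) :
    ‖(s.map fun w => 1 - C (conj w) * X).prod.eval z‖ ≤
      ‖(s.map fun w => X - C w).prod.eval z‖ := by
  induction s using Multiset.induction_on with
  | empty => simp
  | cons w s ih =>
    simp only [Multiset.map_cons, Multiset.prod_cons, eval_mul, norm_mul]
    refine mul_le_mul ?_ (ih fun v hv => hs v (Multiset.mem_cons_of_mem hv)) (norm_nonneg _)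
      (norm_nonneg _)
    simpa using (norm_lt_norm_sub_of_one_lt_norm (hs w (Multiset.mem_cons_self w s)) hz).le

theorem eval_prod_ne_zero {s : Multiset ℂ} (hs : ∀ w ∈ s, ‖w‖ < 1) {z : ℂ} (hz : 1 ≤ ‖z‖) :
    (s.map fun w => X - C w).prod.eval z ≠ 0 := by
  rw [eval_multiset_prod, Multiset.map_map]
  refine Multiset.prod_ne_zero ?_
  simp only [Multiset.mem_map, not_exists, not_and]
  intro w hw h
  have : z = w := sub_eq_zero.1 (by simpa using h)
  exact absurd (hs w hw) (by rw [← this]; exact not_lt.2 hz)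

theorem norm_eval_recip_prod_lt {s : Multiset ℂ} (hs : ∀ w ∈ s, ‖w‖ < 1) (h0 : s ≠ 0) {z : ℂ}
    (hz : 1 < ‖z‖) :
    ‖(s.map fun w => 1 - C (conj w) * X).prod.eval z‖ <
      ‖(s.map fun w => X - C w).prod.eval z‖ := by
  obtain ⟨w, hw⟩ := Multiset.exists_mem_of_ne_zero h0
  obtain ⟨t, rfl⟩ := Multiset.exists_cons_of_mem hw
  have ht : ∀ v ∈ t, ‖v‖ < 1 := fun v hv => hs v (Multiset.mem_cons_of_mem hv)
  simp only [Multiset.map_cons, Multiset.prod_cons, eval_mul, norm_mul]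
  refine mul_lt_mul_of_lt_of_le_of_nonneg_of_pos ?_ (norm_eval_recip_prod_le ht hz) (norm_nonneg _)
    (norm_pos_iff.2 (eval_prod_ne_zero ht hz.le))
  simpa using norm_lt_norm_sub_of_one_lt_norm (hs w hw) hz

/-- The logarithmic derivative of a Blaschke product along the unit circle is nonnegative, and
positive unless the product is empty. -/
theorem exists_log_derivative {s : Multiset ℂ} (hs : ∀ w ∈ s, ‖w‖ < 1) {z : ℂ} (hz : ‖z‖ = 1) :
    ∃ r : ℝ, 0 ≤ r ∧ (s ≠ 0 → 0 < r) ∧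
      z * ((derivative (s.map fun w => X - C w).prod).eval z *
          (s.map fun w => 1 - C (conj w) * X).prod.eval z -
        (s.map fun w => X - C w).prod.eval z *
          (derivative (s.map fun w => 1 - C (conj w) * X).prod).eval z) =
      r * ((s.map fun w => X - C w).prod.eval z *
        (s.map fun w => 1 - C (conj w) * X).prod.eval z) := by
  induction s using Multiset.induction_on with
  | empty => exact ⟨0, le_rfl, by simp, by simp⟩
  | cons w s ih =>
    obtain ⟨r, hr, -, h⟩ := ih fun v hv => hs v (Multiset.mem_cons_of_mem hv)
    have hw := hs w (Multiset.mem_cons_self w s)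
    have hc := mul_conj_of_norm_eq_one hz
    have hne : z - w ≠ 0 := fun h0 => by rw [← sub_eq_zero.1 h0, hz] at hw; exact lt_irrefl _ hw
    have hpos : 0 < Complex.normSq (z - w) := Complex.normSq_pos.2 hne
    have hw1 : 0 < 1 - Complex.normSq w := sub_pos.2 ((normSq_lt_one_iff w).2 hw)
    -- A single factor contributes the Poisson kernel `(1 - |w|²) / |z - w|²`, because `1 - conj w z
    -- = z conj(z - w)` on the circle.
    have key : z * ((1 - conj w * z) + (z - w) * conj w) =
        ((1 - Complex.normSq w) / Complex.normSq (z - w) : ℝ) * ((z - w) * (1 - conj w * z)) := by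
      have h1 : 1 - conj w * z = z * conj (z - w) := by rw [map_sub, mul_sub, hc]; ring
      have h2 : (z - w) * (1 - conj w * z) = z * (Complex.normSq (z - w) : ℂ) := by
        rw [h1, ← Complex.mul_conj]; ring
      have hpos' : (Complex.normSq (z - w) : ℂ) ≠ 0 := by exact_mod_cast hpos.ne'
      rw [h2]
      push_cast
      field_simp
      rw [← Complex.mul_conj]
      ring
    refine ⟨r + (1 - Complex.normSq w) / Complex.normSq (z - w), by positivity,
      fun _ => by positivity, ?_⟩
    simp only [Multiset.map_cons, Multiset.prod_cons, derivative_mul, eval_add, eval_mul,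
      derivative_sub, derivative_X, derivative_C, derivative_one, eval_sub, eval_one, eval_X,
      eval_C, zero_mul, zero_add, zero_sub, sub_zero, one_mul, mul_one, eval_neg]
    rw [Complex.ofReal_add]
    linear_combination ((z - w) * (1 - conj w * z)) * h +
      ((s.map fun w => X - C w).prod.eval z *
        (s.map fun w => 1 - C (conj w) * X).prod.eval z) * key

theorem eq_prod_X_sub_C_roots {P : ℂ[X]} (hP : P.Monic) :
    P = (P.roots.map fun w => X - C w).prod := by
  conv_lhs => rw [(IsAlgClosed.splits P).eq_prod_roots, hP, C_1, one_mul]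

theorem recip_eq_prod_roots {P : ℂ[X]} (hP : P.Monic) :
    recip P.natDegree P = (P.roots.map fun w => 1 - C (conj w) * X).prod := by
  have hc : Multiset.card P.roots = P.natDegree := (IsAlgClosed.splits P).natDegree_eq_card_roots.symm
  have := recip_prod_X_sub_C P.roots
  rwa [← eq_prod_X_sub_C_roots hP, hc] at this

theorem eval_recip_ne_zero {P : ℂ[X]} (hP : P.Monic) (hroots : ∀ w, P.IsRoot w → ‖w‖ < 1)
    {z : ℂ} (hz : ‖z‖ ≤ 1) : (recip P.natDegree P).eval z ≠ 0 := by
  rw [recip_eq_prod_roots hP]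
  exact eval_recip_prod_ne_zero (fun w hw => hroots w (isRoot_of_mem_roots hw)) hz

/-- If `P` is a nonconstant monic polynomial with all zeros in the open unit disc, then all zeros
of `P + τ P^*`, `|τ| = 1`, are simple and lie on the unit circle. -/
theorem simpleZerosOnCircle_add_recip {P : ℂ[X]} (hP : P.Monic) (hd : 0 < P.natDegree)
    (hroots : ∀ w, P.IsRoot w → ‖w‖ < 1) {τ : ℂ} (hτ : ‖τ‖ = 1) :
    SimpleZerosOnCircle (P + C τ * recip P.natDegree P) := by
  have hs : ∀ w ∈ P.roots, ‖w‖ < 1 := fun w hw => hroots w (isRoot_of_mem_roots hw)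
  have h0 : P.roots ≠ 0 := by
    rw [← Multiset.card_pos, ← (IsAlgClosed.splits P).natDegree_eq_card_roots]; exact hd
  have hPe := eq_prod_X_sub_C_roots hP
  have hPr := recip_eq_prod_roots hP
  set R := recip P.natDegree P
  have key : ∀ z, (P + C τ * R).IsRoot z → P.eval z = -(τ * R.eval z) := by
    intro z hz
    have : P.eval z + τ * R.eval z = 0 := by simpa using hz
    linear_combination this
  have hnorm : ∀ z, (P + C τ * R).IsRoot z → ‖P.eval z‖ = ‖R.eval z‖ := by
    intro z hz
    rw [key z hz, norm_neg, norm_mul, hτ, one_mul]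
  -- At the origin `|P| < |R|`, so the sum cannot vanish identically.
  have hne : P + C τ * R ≠ 0 := by
    intro h
    have h1 := hnorm 0 (by rw [h]; simp)
    have h2 := norm_eval_prod_lt hs h0 (z := 0) (by simp)
    rw [← hPe, ← hPr] at h2
    exact h2.ne h1
  intro z hz
  have hz1 : ‖z‖ = 1 := by
    rcases lt_trichotomy ‖z‖ 1 with h | h | h
    · have h2 := norm_eval_prod_lt hs h0 h
      rw [← hPe, ← hPr] at h2
      exact absurd (hnorm z hz) h2.ne
    · exact h
    · have h2 := norm_eval_recip_prod_lt hs h0 h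
      rw [← hPe, ← hPr] at h2
      exact absurd (hnorm z hz) h2.ne'
  refine ⟨hz1, le_antisymm ?_ ((rootMultiplicity_pos hne).2 hz)⟩
  -- At a multiple zero `P = -τ R` and `P' = -τ R'`, hence `P' R - P R' = 0`, against the strictly
  -- positive logarithmic derivative of `P / R`.
  by_contra! hlt
  obtain ⟨-, hd'⟩ := (one_lt_rootMultiplicity_iff_isRoot hne).1 hlt
  have hder : (derivative P).eval z + τ * (derivative R).eval z = 0 := by
    simpa [derivative_C_mul] using hd'
  obtain ⟨r, -, hr, h⟩ := exists_log_derivative hs hz1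
  rw [← hPe, ← hPr] at h
  have hPz : P.eval z ≠ 0 := by rw [hPe]; exact eval_prod_ne_zero hs hz1.ge
  have hRz : R.eval z ≠ 0 := by rw [hPr]; exact eval_recip_prod_ne_zero hs hz1.le
  have hk := key z hz
  have : (r : ℂ) * (P.eval z * R.eval z) = 0 := by
    rw [← h]
    linear_combination z * R.eval z * hder - z * (derivative R).eval z * hk
  have hr0 : (r : ℂ) ≠ 0 := by exact_mod_cast (hr h0).ne'
  exact mul_ne_zero hr0 (mul_ne_zero hPz hRz) this

/-! ### Möbius transformations of the circle and orientation -/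

/-- Twice the signed area of the triangle `a c b`. -/
noncomputable def signedArea (a c b : ℂ) : ℝ := (conj a * c + conj c * b + conj b * a).im

theorem signedArea_swap (a c b : ℂ) : signedArea b c a = -signedArea a c b := by
  simp only [signedArea, Complex.add_im, Complex.mul_im, Complex.conj_re, Complex.conj_im]
  ring

/-- The expression equals `4 sin x sin y sin (x + y)`. With `x`, `y` half the arc lengths, it is
twice the area of the inscribed triangle. -/
theorem sin_add_sin_sub_sin_pos {x y : ℝ} (hx : 0 < x) (hy : 0 < y) (hxy : x + y < Real.pi) :
    0 < Real.sin (2 * x) + Real.sin (2 * y) - Real.sin (2 * x + 2 * y) := by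
  have h1 := Real.sin_pos_of_pos_of_lt_pi hx (by linarith)
  have h2 := Real.sin_pos_of_pos_of_lt_pi hy (by linarith)
  have h3 := Real.sin_pos_of_pos_of_lt_pi (add_pos hx hy) hxy
  have h : Real.sin (2 * x) + Real.sin (2 * y) - Real.sin (2 * x + 2 * y) =
      4 * (Real.sin x * Real.sin y * Real.sin (x + y)) := by
    rw [Real.sin_add (2 * x), Real.sin_two_mul, Real.sin_two_mul, Real.cos_two_mul,
      Real.cos_two_mul, Real.sin_add]
    have hx2 := Real.sin_sq_add_cos_sq x
    have hy2 := Real.sin_sq_add_cos_sq y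
    linear_combination (-4 * Real.sin y * Real.cos y) * hx2 - 4 * Real.sin x * Real.cos x * hy2
  rw [h]
  positivity

theorem IsCounterclockwise.signedArea_pos {a c b : ℂ} (h : IsCounterclockwise a c b) :
    0 < signedArea a c b := by
  obtain ⟨r, s, t, hrs, hst, htr, rfl, rfl, rfl⟩ := h
  have key := sin_add_sin_sub_sin_pos (x := (s - r) / 2) (y := (t - s) / 2) (by linarith)
    (by linarith) (by linarith)
  convert key using 1
  simp only [signedArea, Complex.add_im, Complex.mul_im, Complex.conj_re, Complex.conj_im,
    Complex.exp_ofReal_mul_I_re, Complex.exp_ofReal_mul_I_im]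
  rw [show 2 * ((s - r) / 2) = s - r by ring, show 2 * ((t - s) / 2) = t - s by ring,
    show s - r + (t - s) = t - r by ring, Real.sin_sub, Real.sin_sub, Real.sin_sub]
  ring

theorem SameOrientation.signedArea_mul_pos {a c b a' c' b' : ℂ}
    (h : SameOrientation a c b a' c' b') : 0 < signedArea a c b * signedArea a' c' b' := by
  rcases h with ⟨h, h'⟩ | ⟨h, h'⟩
  · exact mul_pos h.signedArea_pos h'.signedArea_pos
  · have h1 := IsCounterclockwise.signedArea_pos h
    have h2 := IsCounterclockwise.signedArea_pos h'
    rw [signedArea_swap] at h1 h2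
    nlinarith

/-- This turns orientation into a product of differences, which transforms multiplicatively under
Möbius maps. -/
theorem vandermonde_eq_signedArea {a c b : ℂ} (ha : ‖a‖ = 1) (hc : ‖c‖ = 1) (hb : ‖b‖ = 1) :
    (c - a) * (b - c) * (a - b) = 2 * Complex.I * signedArea a c b * (a * c * b) := by
  have h : 2 * Complex.I * (signedArea a c b : ℂ) =
      (conj a * c + conj c * b + conj b * a) - (a * conj c + c * conj b + b * conj a) := by
    have := Complex.sub_conj (conj a * c + conj c * b + conj b * a)
    simp only [map_add, map_mul, Complex.conj_conj] at this
    rw [signedArea]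
    push_cast at this
    linear_combination -this
  rw [h]
  linear_combination (-(b * c ^ 2 - c * b ^ 2)) * mul_conj_of_norm_eq_one ha -
    (a * b ^ 2 - b * a ^ 2) * mul_conj_of_norm_eq_one hc -
    (c * a ^ 2 - a * c ^ 2) * mul_conj_of_norm_eq_one hb

/-- A Möbius transformation `z ↦ (p z + q) / (conj q z + conj p)` mapping three points of the
circle to three distinct points of the circle with the same orientation preserves the disc. -/
theorem norm_lt_norm_of_signedArea {α f : Fin 3 → ℂ} (hα : ∀ i, ‖α i‖ = 1) (hf : ∀ i, ‖f i‖ = 1)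
    (hinj : Function.Injective α)
    (hor : 0 < signedArea (α 0) (α 1) (α 2) * signedArea (f 0) (f 1) (f 2)) {p q : ℂ}
    (hpq : p ≠ 0 ∨ q ≠ 0) (h : ∀ i, p * α i + q = f i * (conj q * α i + conj p)) :
    ‖q‖ < ‖p‖ := by
  set w : Fin 3 → ℂ := fun i => conj q * α i + conj p with hw
  set Δ : ℝ := Complex.normSq p - Complex.normSq q with hΔ
  have hΔ' : (Δ : ℂ) = p * conj p - q * conj q := by
    rw [hΔ, Complex.mul_conj, Complex.mul_conj]; push_cast; ring
  -- The difference formula for a Möbius map of determinant `Δ`, with the denominators `w i` cleared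
  -- so that they may vanish.
  have hdiff : ∀ i j, (f i - f j) * (w i * w j) = Δ * (α i - α j) := by
    intro i j
    have hi := h i
    have hj := h j
    simp only [hw]
    rw [hΔ']
    linear_combination (-(conj q * α j + conj p)) * hi + (conj q * α i + conj p) * hj
  -- On the circle the numerator `p α + q` is `α` times the conjugate of the denominator.
  have hfw : ∀ i, f i * (w i * w i) = α i * (Complex.normSq (w i) : ℂ) := by
    intro i
    rw [← Complex.mul_conj]
    have hi := h i
    simp only [hw, map_add, map_mul, Complex.conj_conj]
    linear_combination (-(conj q * α i + conj p)) * hi +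
      (-(conj q * α i + conj p) * q) * mul_conj_of_norm_eq_one (hα i)
  have hV := vandermonde_eq_signedArea (hα 0) (hα 1) (hα 2)
  have hVf := vandermonde_eq_signedArea (hf 0) (hf 1) (hf 2)
  have hA0 : α 0 * α 1 * α 2 ≠ 0 := mul_ne_zero (mul_ne_zero (ne_zero_of_norm_eq_one (hα 0))
    (ne_zero_of_norm_eq_one (hα 1))) (ne_zero_of_norm_eq_one (hα 2))
  have hE : (signedArea (f 0) (f 1) (f 2) : ℂ) *
      (Complex.normSq (w 0) * Complex.normSq (w 1) * Complex.normSq (w 2)) =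
      Δ ^ 3 * signedArea (α 0) (α 1) (α 2) := by
    have h2 : (2 * Complex.I) * (α 0 * α 1 * α 2) ≠ 0 :=
      mul_ne_zero (mul_ne_zero two_ne_zero Complex.I_ne_zero) hA0
    apply mul_left_cancel₀ h2
    have e1 : (f 1 - f 0) * (f 2 - f 1) * (f 0 - f 2) * ((w 0 * w 0) * (w 1 * w 1) * (w 2 * w 2)) =
        Δ ^ 3 * ((α 1 - α 0) * (α 2 - α 1) * (α 0 - α 2)) := by
      calc _ = ((f 1 - f 0) * (w 1 * w 0)) * ((f 2 - f 1) * (w 2 * w 1)) *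
            ((f 0 - f 2) * (w 0 * w 2)) := by ring
        _ = _ := by rw [hdiff, hdiff, hdiff]; ring
    rw [hV, hVf] at e1
    calc _ = (2 * Complex.I) * signedArea (f 0) (f 1) (f 2) * ((α 0 * Complex.normSq (w 0)) *
          (α 1 * Complex.normSq (w 1)) * (α 2 * Complex.normSq (w 2))) := by ring
      _ = _ := by
        rw [← hfw, ← hfw, ← hfw]
        linear_combination e1
  have hE' : signedArea (f 0) (f 1) (f 2) *
      (Complex.normSq (w 0) * Complex.normSq (w 1) * Complex.normSq (w 2)) =
      Δ ^ 3 * signedArea (α 0) (α 1) (α 2) := by exact_mod_cast hE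
  rw [norm_lt_norm_iff_normSq, ← sub_pos]
  change 0 < Δ
  -- If `Δ = 0`, then `hdiff` and the distinctness of the `f i` make one of any two denominators
  -- zero, so at least two vanish; since the `α i` are distinct, this forces `p = q = 0`.
  have hΔ0 : Δ ≠ 0 := by
    intro h0
    have hww : ∀ i j, w i = 0 → w j = 0 → i ≠ j → False := by
      intro i j hi hj hij
      have hq : conj q * (α i - α j) = 0 := by
        simp only [hw] at hi hj
        linear_combination hi - hj
      have hq0 : conj q = 0 :=
        (mul_eq_zero.1 hq).resolve_right (sub_ne_zero.2 fun e => hij (hinj e))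
      have hp0 : conj p = 0 := by simpa [hw, hq0] using hi
      rcases hpq with hp | hq
      · exact hp ((map_eq_zero _).1 hp0)
      · exact hq ((map_eq_zero _).1 hq0)
    have hfne : ∀ i j, f i ≠ f j → w i = 0 ∨ w j = 0 := by
      intro i j hij
      have := hdiff i j
      rw [h0, Complex.ofReal_zero, zero_mul] at this
      exact mul_eq_zero.1 ((mul_eq_zero.1 this).resolve_left (sub_ne_zero.2 hij))
    have hne := (mul_ne_zero_iff.1 hor.ne').2
    have hprod : (f 1 - f 0) * (f 2 - f 1) * (f 0 - f 2) ≠ 0 := by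
      rw [hVf]
      refine mul_ne_zero (mul_ne_zero (mul_ne_zero two_ne_zero Complex.I_ne_zero)
        (by exact_mod_cast hne)) (mul_ne_zero (mul_ne_zero (ne_zero_of_norm_eq_one (hf 0))
        (ne_zero_of_norm_eq_one (hf 1))) (ne_zero_of_norm_eq_one (hf 2)))
    simp only [mul_ne_zero_iff, sub_ne_zero] at hprod
    obtain ⟨⟨h10, h21⟩, h02⟩ := hprod
    rcases hfne 1 0 h10 with h1 | h1
    · rcases hfne 0 2 h02 with h2 | h2
      · exact hww 1 0 h1 h2 (by decide)
      · exact hww 1 2 h1 h2 (by decide)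
    · rcases hfne 2 1 h21 with h2 | h2
      · exact hww 0 2 h1 h2 (by decide)
      · exact hww 0 1 h1 h2 (by decide)
  by_contra! hle
  have hneg : Δ ^ 3 < 0 := Odd.pow_neg (by decide) (lt_of_le_of_ne hle hΔ0)
  have hN : 0 ≤ Complex.normSq (w 0) * Complex.normSq (w 1) * Complex.normSq (w 2) :=
    mul_nonneg (mul_nonneg (Complex.normSq_nonneg _) (Complex.normSq_nonneg _))
      (Complex.normSq_nonneg _)
  have h1 : signedArea (f 0) (f 1) (f 2) ^ 2 *
      (Complex.normSq (w 0) * Complex.normSq (w 1) * Complex.normSq (w 2)) =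
      Δ ^ 3 * (signedArea (α 0) (α 1) (α 2) * signedArea (f 0) (f 1) (f 2)) := by
    linear_combination signedArea (f 0) (f 1) (f 2) * hE'
  have h2 := mul_neg_of_neg_of_pos hneg hor
  have h3 := mul_nonneg (sq_nonneg (signedArea (f 0) (f 1) (f 2))) hN
  linarith

/-- Three interpolation conditions on the circle are satisfied by a nonzero pair `(p, q)`. -/
theorem exists_moebius_interpolation {α f : Fin 3 → ℂ} (hα : ∀ i, ‖α i‖ = 1)
    (hf : ∀ i, ‖f i‖ = 1) :
    ∃ p q : ℂ, (p ≠ 0 ∨ q ≠ 0) ∧ ∀ i, p * α i + q = f i * (conj q * α i + conj p) := by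
  -- Dividing each condition by square roots of `α i` and `f i` makes it say that a complex number
  -- is real: one real linear equation each.
  choose a ha using fun i => IsAlgClosed.exists_pow_nat_eq (α i) (n := 2) two_pos
  choose g hg using fun i => IsAlgClosed.exists_pow_nat_eq (f i) (n := 2) two_pos
  have norm_root : ∀ {x y : ℂ}, x ^ 2 = y → ‖y‖ = 1 → ‖x‖ = 1 := by
    intro x y hxy hy
    rw [← hxy, norm_pow] at hy
    exact (pow_eq_one_iff_of_nonneg (norm_nonneg x) two_ne_zero).1 hy
  let L : (ℂ × ℂ) →ₗ[ℝ] (Fin 3 → ℝ) :=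
    { toFun := fun x i => (x.1 * a i * conj (g i) + x.2 * conj (a i) * conj (g i)).im
      map_add' := by
        intro x y
        ext i
        simp only [Prod.fst_add, Prod.snd_add, Pi.add_apply, ← Complex.add_im]
        congr 1
        ring
      map_smul' := by
        intro c x
        ext i
        simp only [Prod.smul_fst, Prod.smul_snd, Pi.smul_apply, RingHom.id_apply,
          Complex.real_smul, smul_eq_mul, ← Complex.im_ofReal_mul]
        congr 1
        ring }
  have hker : L.ker ≠ ⊥ := LinearMap.ker_ne_bot_of_finrank_lt (by simp)
  obtain ⟨⟨p, q⟩, hmem, hne⟩ := (Submodule.ne_bot_iff _).1 hker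
  refine ⟨p, q, ?_, fun i => ?_⟩
  · by_contra! h
    exact hne (Prod.ext h.1 h.2)
  · have h0 : (p * a i * conj (g i) + q * conj (a i) * conj (g i)).im = 0 :=
      congrFun (LinearMap.mem_ker.1 hmem) i
    have hc := Complex.conj_eq_iff_im.2 h0
    simp only [map_add, map_mul, Complex.conj_conj] at hc
    have h1 := mul_conj_of_norm_eq_one (norm_root (ha i) (hα i))
    have h2 := mul_conj_of_norm_eq_one (norm_root (hg i) (hf i))
    rw [← ha, ← hg]
    linear_combination (-(a i * g i)) * hc +
      (conj p * g i ^ 2 - q * g i * conj (g i)) * h1 - (p * a i ^ 2 + q) * h2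

/-- Three interpolation conditions determine the parameters `η` and `τ`. -/
theorem moebius_parameters_unique {α f : Fin 3 → ℂ} (hinj : Function.Injective α) {η τ η' τ' : ℂ} (hη : ‖η‖ < 1)
    (hτ : ‖τ‖ = 1) (hτ' : ‖τ'‖ = 1)
    (h : ∀ i, (α i - η) + τ * (1 - conj η * α i) * f i = 0)
    (h' : ∀ i, (α i - η') + τ' * (1 - conj η' * α i) * f i = 0) : η' = η ∧ τ' = τ := by
  set A := τ * conj η - τ' * conj η' with hA
  set B := τ' * (1 + η * conj η') - τ * (1 + η' * conj η) with hB
  set D := τ * η' - τ' * η with hD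
  -- Eliminating `f i` leaves a polynomial of degree at most 2 with three distinct zeros, so `A`,
  -- `B`, `D` all vanish.
  have hq : ∀ i, A * α i ^ 2 + B * α i + D = 0 := by
    intro i
    linear_combination τ' * (1 - conj η' * α i) * h i - τ * (1 - conj η * α i) * h' i
  have hlin : ∀ i j, i ≠ j → A * (α i + α j) + B = 0 := by
    intro i j hij
    apply (mul_eq_zero.1 _).resolve_left (sub_ne_zero.2 fun e => hij (hinj e))
    linear_combination hq i - hq j
  have hA0 : A = 0 := by
    apply (mul_eq_zero.1 _).resolve_right
      (sub_ne_zero.2 fun e => absurd (hinj e) (by decide : (0 : Fin 3) ≠ 2))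
    linear_combination hlin 0 1 (by decide) - hlin 1 2 (by decide)
  have hB0 : B = 0 := by linear_combination hlin 0 1 (by decide) - (α 0 + α 1) * hA0
  have hD0 : D = 0 := by linear_combination hq 0 - α 0 ^ 2 * hA0 - α 0 * hB0
  -- `D = 0` reads `τ η' = τ' η`, so `η'` also lies in the disc. Combined with `B = 0` this gives
  -- `τ' (η' - η) (1 - |η|²) = 0`.
  have hnorm : ‖η'‖ = ‖η‖ := by
    have := congrArg norm (sub_eq_zero.1 hD0)
    rwa [norm_mul, norm_mul, hτ, hτ', one_mul, one_mul] at this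
  have hN : η' * conj η' = η * conj η := by
    rw [Complex.mul_conj, Complex.mul_conj, Complex.normSq_eq_norm_sq, Complex.normSq_eq_norm_sq,
      hnorm]
  have hlt := (normSq_lt_one_iff η).2 hη
  have hnn := Complex.normSq_nonneg η
  have hηη : η' = η := by
    have h1 : 1 - η * conj η ≠ 0 := by
      rw [Complex.mul_conj]
      exact_mod_cast (sub_pos.2 hlt).ne'
    have hτ0 := ne_zero_of_norm_eq_one hτ'
    refine sub_eq_zero.1 ((mul_eq_zero.1 ?_).resolve_right (mul_ne_zero h1 hτ0))
    linear_combination η' * hB0 + (1 + η' * conj η) * hD0 - τ' * η * hN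
  refine ⟨hηη, ?_⟩
  have h1 : 1 + η * conj η ≠ 0 := by
    rw [Complex.mul_conj]
    exact_mod_cast (by linarith : (0 : ℝ) < 1 + Complex.normSq η).ne'
  refine sub_eq_zero.1 ((mul_eq_zero.1 ?_).resolve_right h1)
  rw [hB, hηη] at hB0
  linear_combination hB0

/-! ### The inner product and the orthogonal polynomials -/

section InnerProduct

variable {μ : Measure ℂ}

theorem ae_norm_eq_one (hμT : μ (Metric.sphere (0 : ℂ) 1)ᶜ = 0) : ∀ᵐ z ∂μ, ‖z‖ = 1 := by
  filter_upwards [measure_eq_zero_iff_ae_notMem.1 hμT] with z hz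
  simpa using hz

theorem ip_conj (P Q : ℂ[X]) : conj (ip μ P Q) = ip μ Q P := by
  rw [ip, ip, ← integral_conj]
  congr 1
  ext z
  simp [mul_comm]

theorem ip_C_mul (c : ℂ) (P Q : ℂ[X]) : ip μ (C c * P) Q = c * ip μ P Q := by
  rw [ip, ip, ← integral_const_mul]
  congr 1
  ext z
  simp [mul_assoc]

theorem ip_X_mul_X_mul (hμT : μ (Metric.sphere (0 : ℂ) 1)ᶜ = 0) (P Q : ℂ[X]) :
    ip μ (X * P) (X * Q) = ip μ P Q := by
  refine integral_congr_ae ?_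
  filter_upwards [ae_norm_eq_one hμT] with z hz
  simp only [eval_mul, eval_X, map_mul]
  linear_combination (eval z P * conj (eval z Q)) * mul_conj_of_norm_eq_one hz

/-- On the circle `P^* = z^m conj P`, so reciprocation reflects orthogonality conditions by `k ↦ m -
k`. -/
theorem ip_recip_X_pow (hμT : μ (Metric.sphere (0 : ℂ) 1)ᶜ = 0) {m k : ℕ} (hk : k ≤ m) {P : ℂ[X]}
    (hP : P.natDegree ≤ m) : ip μ (recip m P) (X ^ k) = conj (ip μ P (X ^ (m - k))) := by
  rw [ip_conj]
  refine integral_congr_ae ?_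
  filter_upwards [ae_norm_eq_one hμT] with z hz
  simp only [eval_recip hP hz, eval_pow, eval_X, map_pow]
  obtain ⟨j, rfl⟩ := Nat.exists_eq_add_of_le hk
  rw [Nat.add_sub_cancel_left, pow_add]
  have h : z ^ k * conj z ^ k = 1 := by rw [← mul_pow, mul_conj_of_norm_eq_one hz, one_pow]
  linear_combination (z ^ j * conj (eval z P)) * h

theorem rho_natDegree_monic (n : ℕ) : (rho μ n).natDegree = n ∧ (rho μ n).Monic := by
  induction n using Nat.strong_induction_on with
  | _ n ih =>
    have hlt : (∑ k : Fin n, C (ip μ (X ^ n) (rho μ k) / ip μ (rho μ k) (rho μ k)) *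
        rho μ k).degree < n := by
      refine (degree_sum_le _ _).trans_lt ((Finset.sup_lt_iff (WithBot.bot_lt_coe n)).2 ?_)
      intro k _
      refine (degree_mul_le_of_le degree_C_le le_rfl).trans_lt ?_
      rw [zero_add]
      rw [degree_eq_natDegree (ih k k.2).2.ne_zero, (ih k k.2).1]
      exact WithBot.coe_lt_coe.2 k.2
    rw [rho]
    refine ⟨natDegree_eq_of_degree_eq_some ?_, monic_X_pow_sub ?_⟩
    · rw [degree_sub_eq_left_of_degree_lt (by rwa [degree_X_pow]), degree_X_pow]
    · exact hlt

theorem natDegree_rho (n : ℕ) : (rho μ n).natDegree = n := (rho_natDegree_monic n).1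

theorem monic_rho (n : ℕ) : (rho μ n).Monic := (rho_natDegree_monic n).2

theorem ip_self_eq_integral (P : ℂ[X]) : ip μ P P = ((∫ z, ‖P.eval z‖ ^ 2 ∂μ : ℝ) : ℂ) := by
  rw [ip, ← integral_complex_ofReal]
  congr 1
  ext z
  rw [Complex.mul_conj, Complex.normSq_eq_norm_sq]

variable [IsFiniteMeasure μ]

theorem integrable_of_continuous (hμT : μ (Metric.sphere (0 : ℂ) 1)ᶜ = 0) {g : ℂ → ℂ}
    (hg : Continuous g) : Integrable g μ := by
  obtain ⟨M, hM⟩ := (isCompact_sphere (0 : ℂ) 1).exists_bound_of_continuousOn hg.continuousOn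
  refine Integrable.of_bound hg.aestronglyMeasurable M ?_
  filter_upwards [ae_norm_eq_one hμT] with z hz
  exact hM z (by simpa using hz)

theorem integrable_ip (hμT : μ (Metric.sphere (0 : ℂ) 1)ᶜ = 0) (P Q : ℂ[X]) :
    Integrable (fun z => P.eval z * conj (Q.eval z)) μ :=
  integrable_of_continuous hμT (P.continuous.mul (Complex.continuous_conj.comp Q.continuous))

theorem ip_add (hμT : μ (Metric.sphere (0 : ℂ) 1)ᶜ = 0) (P Q R : ℂ[X]) :
    ip μ (P + Q) R = ip μ P R + ip μ Q R := by
  rw [ip, ip, ip, ← integral_add (integrable_ip hμT P R) (integrable_ip hμT Q R)]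
  congr 1
  ext z
  simp [add_mul]

/-- `ip μ · R` as a linear functional. -/
noncomputable def ipLeft (hμT : μ (Metric.sphere (0 : ℂ) 1)ᶜ = 0) (R : ℂ[X]) : ℂ[X] →ₗ[ℂ] ℂ where
  toFun P := ip μ P R
  map_add' P Q := ip_add hμT P Q R
  map_smul' c P := by simp [smul_eq_C_mul, ip_C_mul]

theorem ip_sub (hμT : μ (Metric.sphere (0 : ℂ) 1)ᶜ = 0) (P Q R : ℂ[X]) :
    ip μ (P - Q) R = ip μ P R - ip μ Q R := map_sub (ipLeft hμT R) P Q

theorem ip_sum (hμT : μ (Metric.sphere (0 : ℂ) 1)ᶜ = 0) {ι : Type*} (s : Finset ι) (P : ι → ℂ[X])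
    (R : ℂ[X]) : ip μ (∑ i ∈ s, P i) R = ∑ i ∈ s, ip μ (P i) R := map_sum (ipLeft hμT R) P s

theorem ip_right_eq_zero_of_natDegree_le (hμT : μ (Metric.sphere (0 : ℂ) 1)ᶜ = 0) {n : ℕ}
    {P Q : ℂ[X]} (h : ∀ k ≤ n, ip μ P (X ^ k) = 0) (hQ : Q.natDegree ≤ n) : ip μ P Q = 0 := by
  rw [← ip_conj, map_eq_zero, Q.as_sum_range_C_mul_X_pow, ip_sum hμT]
  refine Finset.sum_eq_zero fun k hk => ?_
  rw [ip_C_mul, ← ip_conj, h k (by have := Finset.mem_range.1 hk; omega), map_zero, mul_zero]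

theorem eq_zero_of_ip_self_eq_zero (hμT : μ (Metric.sphere (0 : ℂ) 1)ᶜ = 0)
    (hμ : μ.support.Infinite) {P : ℂ[X]} (h : ip μ P P = 0) : P = 0 := by
  by_contra hP
  rw [ip_self_eq_integral, Complex.ofReal_eq_zero, integral_eq_zero_iff_of_nonneg
    (fun z => by positivity)] at h
  -- `P` vanishes almost everywhere, and its zero set is closed, so this finite set contains the
  -- support.
  · refine hμ ((P.rootSet_finite ℂ).subset (Measure.support_subset_of_isClosed
      (P.rootSet_finite ℂ).isClosed ?_))
    filter_upwards [h] with z hz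
    rw [mem_rootSet]
    exact ⟨hP, by simpa using hz⟩
  · have := (integrable_ip hμT P P).norm
    refine this.congr (Filter.Eventually.of_forall fun z => ?_)
    simp [sq]

theorem ip_self_pos (hμT : μ (Metric.sphere (0 : ℂ) 1)ᶜ = 0)
    (hμ : μ.support.Infinite) {P : ℂ[X]} (hP : P ≠ 0) : ∃ r : ℝ, 0 < r ∧ ip μ P P = r := by
  refine ⟨_, lt_of_le_of_ne (integral_nonneg fun z => by positivity) ?_, ip_self_eq_integral P⟩
  intro h
  refine hP (eq_zero_of_ip_self_eq_zero hμT hμ ?_)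
  rw [ip_self_eq_integral, ← h, Complex.ofReal_zero]

theorem ip_rho_rho (hμT : μ (Metric.sphere (0 : ℂ) 1)ᶜ = 0) (hμ : μ.support.Infinite) (n : ℕ) :
    ∀ k < n, ip μ (rho μ n) (rho μ k) = 0 := by
  induction n using Nat.strong_induction_on with
  | _ n ih =>
    intro k hk
    have hne : ip μ (rho μ k) (rho μ k) ≠ 0 := fun h =>
      (monic_rho k).ne_zero (eq_zero_of_ip_self_eq_zero hμT hμ h)
    rw [rho, ip_sub hμT, ip_sum hμT, Finset.sum_eq_single (⟨k, hk⟩ : Fin n)]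
    · rw [ip_C_mul, div_mul_cancel₀ _ hne, sub_self]
    · intro j _ hj
      rw [ip_C_mul]
      have hjk : (j : ℕ) ≠ k := fun h => hj (Fin.ext h)
      rcases lt_or_gt_of_ne hjk with h | h
      · rw [← ip_conj (rho μ k), ih k hk j h, map_zero, mul_zero]
      · rw [ih j j.2 k h, mul_zero]
    · simp

theorem ip_rho_X_pow (hμT : μ (Metric.sphere (0 : ℂ) 1)ᶜ = 0) (hμ : μ.support.Infinite) {n k : ℕ}
    (hk : k < n) : ip μ (rho μ n) (X ^ k) = 0 := by
  have h : (X ^ k : ℂ[X]) = rho μ k +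
      ∑ j : Fin k, C (ip μ (X ^ k) (rho μ j) / ip μ (rho μ j) (rho μ j)) * rho μ j := by
    rw [rho, sub_add_cancel]
  rw [← ip_conj, map_eq_zero, h, ip_add hμT, ip_sum hμT, ← ip_conj, ip_rho_rho hμT hμ n k hk,
    map_zero, zero_add]
  refine Finset.sum_eq_zero fun j _ => ?_
  rw [ip_C_mul, ← ip_conj (rho μ n), ip_rho_rho hμT hμ n j (j.2.trans hk), map_zero, mul_zero]

theorem ip_rho_of_natDegree_lt (hμT : μ (Metric.sphere (0 : ℂ) 1)ᶜ = 0) (hμ : μ.support.Infinite)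
    {n : ℕ} {Q : ℂ[X]} (hQ : Q.natDegree < n) : ip μ (rho μ n) Q = 0 :=
  ip_right_eq_zero_of_natDegree_le hμT
    (fun _ hk => ip_rho_X_pow hμT hμ (hk.trans_lt hQ)) le_rfl

theorem ip_rho_X_pow_self (hμT : μ (Metric.sphere (0 : ℂ) 1)ᶜ = 0) (hμ : μ.support.Infinite)
    (n : ℕ) : ip μ (rho μ n) (X ^ n) = ip μ (rho μ n) (rho μ n) := by
  rcases Nat.eq_zero_or_pos n with rfl | hn
  · have h : rho μ 0 = 1 := by rw [rho]; simp
    rw [h, pow_zero]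
  have h : ip μ (rho μ n) (X ^ n - rho μ n) = 0 := by
    refine ip_rho_of_natDegree_lt hμT hμ ?_
    have hd : (X ^ n - rho μ n : ℂ[X]).degree < n := by
      have := degree_sub_lt_left (p := (X ^ n : ℂ[X])) (q := rho μ n)
        (by rw [degree_X_pow, degree_eq_natDegree (monic_rho n).ne_zero, natDegree_rho])
        (by simp) (by rw [(monic_X_pow n).leadingCoeff, (monic_rho n).leadingCoeff])
      rwa [degree_X_pow] at this
    rcases eq_or_ne (X ^ n - rho μ n : ℂ[X]) 0 with h0 | h0
    · rw [h0, natDegree_zero]; exact hn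
    · exact (natDegree_lt_iff_degree_lt h0).2 hd
  rw [← ip_conj, ip_sub hμT, map_sub, ip_conj, ip_conj] at h
  exact sub_eq_zero.1 h

/-- All zeros of `ρ_n` lie in the open unit disc. -/
theorem norm_lt_one_of_isRoot_rho (hμT : μ (Metric.sphere (0 : ℂ) 1)ᶜ = 0)
    (hμ : μ.support.Infinite) {n : ℕ} {w : ℂ} (hw : (rho μ n).IsRoot w) : ‖w‖ < 1 := by
  obtain ⟨π, hπ⟩ := dvd_iff_isRoot.2 hw
  have hρ0 : rho μ n ≠ 0 := (monic_rho n).ne_zero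
  have hπ0 : π ≠ 0 := by rintro rfl; exact hρ0 (by rw [hπ, mul_zero])
  have hdeg : π.natDegree < n := by
    have h := natDegree_mul (X_sub_C_ne_zero w) hπ0
    rw [← hπ, natDegree_rho, natDegree_X_sub_C] at h
    omega
  have horth : ip μ (rho μ n) π = 0 := ip_rho_of_natDegree_lt hμT hμ hdeg
  obtain ⟨r, hr, hr'⟩ := ip_self_pos hμT hμ hρ0
  obtain ⟨s, hs, hs'⟩ := ip_self_pos hμT hμ hπ0
  -- Multiplication by `z` is isometric and `ρ_n ⟂ π`, so Pythagoras gives `‖π‖² = ‖ρ_n‖² + |w|²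
  -- ‖π‖²`.
  have hX : X * π = rho μ n + C w * π := by rw [hπ]; ring
  have h1 : ip μ (X * π) (X * π) = r + w * conj w * s := by
    rw [hX, ip_add hμT, ip_C_mul, ← ip_conj (rho μ n + C w * π) (rho μ n),
      ← ip_conj (rho μ n + C w * π) π, ip_add hμT, ip_add hμT, ip_C_mul, ip_C_mul, horth,
      ← ip_conj (rho μ n) π, horth, hr', hs']
    simp only [map_add, map_mul, map_zero, Complex.conj_ofReal]
    ring
  rw [ip_X_mul_X_mul hμT, hs', Complex.mul_conj] at h1
  have h2 : s = r + Complex.normSq w * s := by exact_mod_cast h1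
  rw [← normSq_lt_one_iff]
  nlinarith

end InnerProduct

/-! ### The polynomials `z (z - η) ρ_{n-2} + τ (1 - conj η z) ρ_{n-2}^*` -/

theorem recip_X_mul_X_sub_C_mul {m : ℕ} {P : ℂ[X]} (hP : P.natDegree ≤ m) (η : ℂ) :
    recip (m + 2) (X * (X - C η) * P) = (1 - C (conj η) * X) * recip m P := by
  have h2 : (X * (X - C η) : ℂ[X]).natDegree ≤ 1 + 1 :=
    natDegree_mul_le_of_le natDegree_X_le (natDegree_X_sub_C_le η)
  have hX : recip 1 (X : ℂ[X]) = 1 := by simp [recip]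
  rw [show m + 2 = (1 + 1) + m by ring, recip_mul h2 hP,
    recip_mul natDegree_X_le (natDegree_X_sub_C_le η), recip_one_X_sub_C, hX, one_mul]

theorem recip_X_mul {m : ℕ} {P : ℂ[X]} (hP : P.natDegree ≤ m) :
    recip (m + 2) (X * P) = X * recip m P := by
  have hX : recip 2 (X : ℂ[X]) = X := by
    have h := reflect_monomial (R := ℂ) 2 1
    rw [pow_one, revAt_le (by norm_num)] at h
    simpa [recip] using h
  rw [add_comm m 2, recip_mul (natDegree_X_le.trans (by norm_num)) hP, hX]

/-- The coefficient of `z^n` in `P^*` is the conjugate of `P(0) = 0`, so the added term has lower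
degree. -/
theorem monic_add_recip {n : ℕ} {P : ℂ[X]} (hP : P.Monic) (hn : P.natDegree = n)
    (h0 : P.coeff 0 = 0) (τ : ℂ) :
    (P + C τ * recip n P).Monic ∧ (P + C τ * recip n P).degree = n := by
  have hdeg : P.degree = n := by rw [degree_eq_natDegree hP.ne_zero, hn]
  have hlt : (C τ * recip n P).degree < P.degree := by
    rw [hdeg, degree_lt_iff_coeff_zero]
    intro k hk
    rw [coeff_C_mul]
    rcases hk.eq_or_lt with rfl | hk
    · simp [recip, coeff_reflect, h0]
    · rw [coeff_eq_zero_of_natDegree_lt ((natDegree_recip_le hn.le).trans_lt hk), mul_zero]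
  exact ⟨hP.add_of_left hlt, by rw [degree_add_eq_left_of_degree_lt hlt, hdeg]⟩

theorem add_recip_eq {n : ℕ} (P : ℂ[X]) {τ : ℂ} (hτ : ‖τ‖ = 1) :
    P + C τ * recip n P = C τ * recip n (P + C τ * recip n P) := by
  rw [recip_add, recip_C_mul, recip_recip, mul_add, ← mul_assoc, ← C_mul,
    mul_conj_of_norm_eq_one hτ, C_1, one_mul, add_comm]

variable {μ : Measure ℂ}

theorem q3_eq_add_recip (m : ℕ) (η τ : ℂ) :
    q3 μ (m + 2) η τ = X * (X - C η) * rho μ m +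
      C τ * recip (m + 2) (X * (X - C η) * rho μ m) := by
  rw [recip_X_mul_X_sub_C_mul (natDegree_rho m).le, q3, Nat.add_sub_cancel, mul_assoc (C τ)]

theorem monic_X_mul_X_sub_C_mul_rho (m : ℕ) (η : ℂ) :
    (X * (X - C η) * rho μ m).Monic :=
  (monic_X.mul (monic_X_sub_C η)).mul (monic_rho m)

theorem natDegree_X_mul_X_sub_C_mul_rho (m : ℕ) (η : ℂ) :
    (X * (X - C η) * rho μ m).natDegree = m + 2 := by
  rw [(monic_X.mul (monic_X_sub_C η)).natDegree_mul (monic_rho m),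
    monic_X.natDegree_mul (monic_X_sub_C η), natDegree_X, natDegree_X_sub_C, natDegree_rho]
  ring

theorem monic_q3 (m : ℕ) (η τ : ℂ) :
    (q3 μ (m + 2) η τ).Monic ∧ (q3 μ (m + 2) η τ).degree = (m + 2 : ℕ) := by
  rw [q3_eq_add_recip]
  exact monic_add_recip (monic_X_mul_X_sub_C_mul_rho m η) (natDegree_X_mul_X_sub_C_mul_rho m η)
    (by simp [mul_assoc]) τ

theorem isInvariant_q3 (m : ℕ) (η : ℂ) {τ : ℂ} (hτ : ‖τ‖ = 1) :
    IsInvariant (m + 2) (q3 μ (m + 2) η τ) := by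
  refine ⟨(monic_q3 m η τ).2, τ, hτ, ?_⟩
  rw [q3_eq_add_recip]
  exact add_recip_eq _ hτ

theorem blaschke_eq (m : ℕ) (z : ℂ) :
    blaschke μ (m + 1) z = z * (rho μ m).eval z / (recip m (rho μ m)).eval z := rfl

variable [IsFiniteMeasure μ]

theorem ip_q3_X_pow (hμT : μ (Metric.sphere (0 : ℂ) 1)ᶜ = 0) (hμ : μ.support.Infinite)
    {m k : ℕ} (hk : 2 ≤ k) (hkm : k ≤ m) (η τ : ℂ) : ip μ (q3 μ (m + 2) η τ) (X ^ k) = 0 := by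
  have key : ∀ j, 2 ≤ j → j ≤ m → ip μ (X * (X - C η) * rho μ m) (X ^ j) = 0 := by
    intro j hj hjm
    obtain ⟨i, rfl⟩ := Nat.exists_eq_add_of_le' hj
    rw [mul_assoc, pow_succ', ip_X_mul_X_mul hμT, sub_mul, ip_sub hμT, ip_C_mul,
      ip_rho_X_pow hμT hμ (by omega), pow_succ', ip_X_mul_X_mul hμT,
      ip_rho_X_pow hμT hμ (by omega), mul_zero, sub_zero]
  rw [q3_eq_add_recip, ip_add hμT, ip_C_mul, key k hk hkm,
    ip_recip_X_pow hμT (by omega) (natDegree_X_mul_X_sub_C_mul_rho m η).le,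
    key (m + 2 - k) (by omega) (by omega), map_zero, mul_zero, add_zero]

theorem isQPOPUC_q3 (hμT : μ (Metric.sphere (0 : ℂ) 1)ᶜ = 0) (hμ : μ.support.Infinite)
    (m : ℕ) (η : ℂ) {τ : ℂ} (hτ : ‖τ‖ = 1) : IsQPOPUC μ (m + 2) 1 (q3 μ (m + 2) η τ) :=
  ⟨isInvariant_q3 m η hτ, fun _ hk hkm => ip_q3_X_pow hμT hμ hk (by omega) η τ⟩

theorem simpleZerosOnCircle_q3 (hμT : μ (Metric.sphere (0 : ℂ) 1)ᶜ = 0) (hμ : μ.support.Infinite)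
    (m : ℕ) {η τ : ℂ} (hη : ‖η‖ < 1) (hτ : ‖τ‖ = 1) :
    SimpleZerosOnCircle (q3 μ (m + 2) η τ) := by
  have hd := natDegree_X_mul_X_sub_C_mul_rho (μ := μ) m η
  have h := simpleZerosOnCircle_add_recip (monic_X_mul_X_sub_C_mul_rho (μ := μ) m η)
    (by rw [hd]; omega) ?_ hτ
  · rwa [hd, ← q3_eq_add_recip] at h
  · intro w hw
    rw [root_mul, root_mul, root_X_sub_C] at hw
    rcases hw with (hw | rfl) | hw
    · have : w = 0 := by simpa using hw
      simp [this]
    · exact hη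
    · exact norm_lt_one_of_isRoot_rho hμT hμ hw

/-- A polynomial of degree at most `m` orthogonal to `z, …, z^{m-1}` is a linear combination of
`ρ_m` and `ρ_m^*`. -/
theorem exists_eq_rho_add_recip (hμT : μ (Metric.sphere (0 : ℂ) 1)ᶜ = 0)
    (hμ : μ.support.Infinite) {m : ℕ} (hm : 1 ≤ m) {S : ℂ[X]} (hS : S.natDegree ≤ m)
    (horth : ∀ j, 1 ≤ j → j < m → ip μ S (X ^ j) = 0) :
    ∃ b d : ℂ, S = C b * rho μ m + C d * recip m (rho μ m) := by
  obtain ⟨N, hN, hN'⟩ := ip_self_pos hμT hμ (monic_rho (μ := μ) m).ne_zero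
  have hN0 : (N : ℂ) ≠ 0 := by exact_mod_cast hN.ne'
  have hd := (natDegree_rho (μ := μ) m).le
  have hm' := ip_rho_X_pow_self hμT hμ m
  rw [hN'] at hm'
  set ρ := rho μ m with hρ
  -- `ρ_m` is orthogonal to `1, …, z^{m-1}` and `ρ_m^*` to `z, …, z^m`, so `z^m` and `1` read off
  -- the two coefficients separately.
  set b := ip μ S (X ^ m) / N
  set d := ip μ S (X ^ 0) / N
  refine ⟨b, d, sub_eq_zero.1 (eq_zero_of_ip_self_eq_zero hμT hμ
    (ip_right_eq_zero_of_natDegree_le hμT (n := m) (fun k hk => ?_) ?_))⟩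
  · rw [ip_sub hμT, ip_add hμT, ip_C_mul, ip_C_mul, ip_recip_X_pow hμT hk hd]
    rcases Nat.eq_zero_or_pos k with rfl | hk0
    · rw [Nat.sub_zero, hm', ip_rho_X_pow hμT hμ hm, Complex.conj_ofReal, div_mul_cancel₀ _ hN0]
      ring
    · rcases hk.eq_or_lt with rfl | hkm
      · rw [Nat.sub_self, hm', ip_rho_X_pow hμT hμ hm, div_mul_cancel₀ _ hN0]
        simp
      · rw [horth k hk0 hkm, ip_rho_X_pow hμT hμ hkm, ip_rho_X_pow hμT hμ (by omega)]
        simp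
  · refine (natDegree_sub_le _ _).trans (max_le hS ((natDegree_add_le _ _).trans (max_le ?_ ?_)))
    · exact (natDegree_C_mul_le _ _).trans hd
    · exact (natDegree_C_mul_le _ _).trans (natDegree_recip_le hd)

/-- Every monic QPOPUC of order `3` has the form `q3 μ n η τ`. -/
theorem exists_eq_q3 (hμT : μ (Metric.sphere (0 : ℂ) 1)ᶜ = 0)
    (hμ : μ.support.Infinite) {m : ℕ} (hm : 1 ≤ m) {Q : ℂ[X]} (hQ : IsQPOPUC μ (m + 2) 1 Q)
    (hmonic : Q.Monic) : ∃ η τ : ℂ, ‖τ‖ = 1 ∧ Q = q3 μ (m + 2) η τ := by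
  obtain ⟨⟨hdeg, τ, hτ, hinv⟩, horth⟩ := hQ
  have hnat : Q.natDegree = m + 2 := natDegree_eq_of_degree_eq_some hdeg
  have hlead : Q.coeff (m + 2) = 1 := by rw [← hnat]; exact hmonic
  have hQ0 : Q.coeff 0 = τ := by
    rw [hinv, coeff_C_mul, coeff_zero_recip, hlead, map_one, mul_one]
  have hd := (natDegree_rho (μ := μ) m).le
  obtain ⟨hq3, hq3d⟩ := monic_q3 (μ := μ) m 0 τ
  have hq3n : (q3 μ (m + 2) 0 τ).natDegree = m + 2 := natDegree_eq_of_degree_eq_some hq3d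
  have hq3c : (q3 μ (m + 2) 0 τ).coeff (m + 2) = 1 := by
    have := hq3
    rwa [Monic, leadingCoeff, hq3n] at this
  have hq3i : q3 μ (m + 2) 0 τ = C τ * recip (m + 2) (q3 μ (m + 2) 0 τ) := by
    rw [q3_eq_add_recip]
    exact add_recip_eq _ hτ
  have hq30 : (q3 μ (m + 2) 0 τ).coeff 0 = τ := by
    rw [hq3i, coeff_C_mul, coeff_zero_recip, hq3c, map_one, mul_one]
  -- Both polynomials are monic of degree `m + 2` with constant term `τ`. Their difference is
  -- therefore `z S` with `deg S ≤ m`, and `S` is orthogonal to `z, …, z^{m-1}`.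
  obtain ⟨R, hR⟩ : ∃ R, R = Q - q3 μ (m + 2) 0 τ := ⟨_, rfl⟩
  have hRi : R = C τ * recip (m + 2) R := by
    have hQR : Q = R + q3 μ (m + 2) 0 τ := by rw [hR]; ring
    have h := hinv
    rw [hQR, recip_add, mul_add, ← hq3i] at h
    exact add_right_cancel h
  have hRX : R = X * R.divX := by
    conv_lhs => rw [← X_mul_divX_add R]
    rw [hR, coeff_sub, hQ0, hq30, sub_self, C_0, add_zero]
  have hRd : R.natDegree ≤ m + 1 := by
    rw [natDegree_le_iff_coeff_eq_zero]
    intro k hk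
    rcases (show m + 2 ≤ k from hk).eq_or_lt with rfl | hk
    · rw [hR, coeff_sub, hlead, hq3c, sub_self]
    · rw [hR, coeff_sub, coeff_eq_zero_of_natDegree_lt (by omega),
        coeff_eq_zero_of_natDegree_lt (by omega), sub_self]
  obtain ⟨b, d, hS⟩ := exists_eq_rho_add_recip hμT hμ hm (S := R.divX)
    (by rw [natDegree_divX_eq_natDegree_tsub_one]; omega) (by
      intro j hj hjm
      rw [← ip_X_mul_X_mul hμT, ← hRX, ← pow_succ', hR, ip_sub hμT,
        horth (j + 1) (by omega) (by omega), ip_q3_X_pow hμT hμ (by omega) (by omega), sub_zero])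
  rw [hS] at hRX
  have hrd := natDegree_recip_le hd
  have hRr : R = C τ * (X * (C (conj b) * recip m (rho μ m) + C (conj d) * rho μ m)) := by
    rw [hRi]
    conv_lhs => rw [hRX]
    rw [recip_X_mul, recip_add, recip_C_mul, recip_C_mul, recip_recip]
    exact (natDegree_add_le _ _).trans (max_le ((natDegree_C_mul_le _ _).trans hd)
      ((natDegree_C_mul_le _ _).trans hrd))
  -- Averaging the expressions for `R` and `τ R^*` makes the coefficients of `z ρ_m` and `z ρ_m^*`
  -- equal to `-η` and `-τ conj η`, without appeal to linear independence of `ρ_m` and `ρ_m^*`.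
  refine ⟨-((b + τ * conj d) / 2), τ, hτ, ?_⟩
  have hQR : Q = R + q3 μ (m + 2) 0 τ := by rw [hR]; ring
  have hhalf : R = C (1 / 2) * (R + R) := by
    rw [← two_mul, ← mul_assoc, ← C_ofNat, ← C_mul]; norm_num
  have hτC : C τ * C (conj τ) = 1 := by rw [← C_mul, mul_conj_of_norm_eq_one hτ, C_1]
  have hR' : R = C (1 / 2) * (X * (C b * rho μ m + C d * recip m (rho μ m)) +
      C τ * (X * (C (conj b) * recip m (rho μ m) + C (conj d) * rho μ m))) := by
    rw [← hRX, ← hRr, ← hhalf]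
  have h2 : conj (-((b + τ * conj d) / 2)) = -(1 / 2 * (conj b + conj τ * d)) := by
    simp only [map_neg, map_div₀, map_add, map_mul, Complex.conj_conj, map_ofNat]
    ring
  have h1 : -((b + τ * conj d) / 2) = -(1 / 2 * (b + τ * conj d)) := by ring
  rw [hQR, hR', q3, q3, Nat.add_sub_cancel, h2, h1]
  simp only [map_neg, map_mul, map_add, map_zero]
  linear_combination (-(C (1 / 2) * C d * X * recip m (rho μ m))) * hτC

/-! ### Interpolation -/

theorem eval_recip_rho_ne_zero (hμT : μ (Metric.sphere (0 : ℂ) 1)ᶜ = 0) (hμ : μ.support.Infinite)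
    (m : ℕ) {z : ℂ} (hz : ‖z‖ ≤ 1) : (recip m (rho μ m)).eval z ≠ 0 := by
  have := eval_recip_ne_zero (monic_rho (μ := μ) m)
    (fun w hw => norm_lt_one_of_isRoot_rho hμT hμ hw) hz
  rwa [natDegree_rho] at this

theorem norm_blaschke (hμT : μ (Metric.sphere (0 : ℂ) 1)ᶜ = 0) (hμ : μ.support.Infinite)
    (m : ℕ) {z : ℂ} (hz : ‖z‖ = 1) : ‖blaschke μ (m + 1) z‖ = 1 := by
  have h0 := eval_recip_rho_ne_zero hμT hμ m hz.le
  have h1 : ‖(recip m (rho μ m)).eval z‖ = ‖(rho μ m).eval z‖ := by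
    rw [eval_recip (natDegree_rho m).le hz, norm_mul, norm_pow, hz, one_pow, one_mul,
      Complex.norm_conj]
  rw [blaschke_eq, norm_div, norm_mul, hz, one_mul, h1, div_self]
  rw [← h1]
  exact norm_ne_zero_iff.2 h0

theorem isRoot_q3_iff (hμT : μ (Metric.sphere (0 : ℂ) 1)ᶜ = 0) (hμ : μ.support.Infinite)
    (m : ℕ) {z : ℂ} (hz : ‖z‖ = 1) (η τ : ℂ) :
    (q3 μ (m + 2) η τ).IsRoot z ↔
      (z - η) + τ * (1 - conj η * z) * conj (blaschke μ (m + 1) z) = 0 := by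
  have h0 := eval_recip_rho_ne_zero hμT hμ m hz.le
  have hF := norm_blaschke hμT hμ m hz
  have hF0 := ne_zero_of_norm_eq_one hF
  have hFc := mul_conj_of_norm_eq_one hF
  have hFr : blaschke μ (m + 1) z * (recip m (rho μ m)).eval z = z * (rho μ m).eval z := by
    rw [blaschke_eq, div_mul_cancel₀ _ h0]
  have h : (q3 μ (m + 2) η τ).eval z = ((recip m (rho μ m)).eval z * blaschke μ (m + 1) z) *
      ((z - η) + τ * (1 - conj η * z) * conj (blaschke μ (m + 1) z)) := by
    simp only [q3, Nat.add_sub_cancel, eval_add, eval_mul, eval_sub, eval_X, eval_C, eval_one]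
    linear_combination (-(z - η)) * hFr -
      (τ * (1 - conj η * z) * (recip m (rho μ m)).eval z) * hFc
  rw [IsRoot.def, h, mul_eq_zero, or_iff_right (mul_ne_zero h0 hF0)]

theorem norm_lt_one_of_interpolation {α f : Fin 3 → ℂ} (hα : ∀ i, ‖α i‖ = 1)
    (hf : ∀ i, ‖f i‖ = 1) (hinj : Function.Injective α)
    (hor : 0 < signedArea (α 0) (α 1) (α 2) * signedArea (f 0) (f 1) (f 2)) {η τ : ℂ}
    (hτ : ‖τ‖ = 1) (h : ∀ i, (α i - η) + τ * (1 - conj η * α i) * f i = 0) : ‖η‖ < 1 := by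
  -- This `p` satisfies `conj p = -τ p`, so multiplying the conditions by `p` puts them in
  -- homogeneous form with `q = -η p`.
  obtain ⟨p, hp⟩ := IsAlgClosed.exists_pow_nat_eq (-conj τ) (n := 2) two_pos
  have hp1 : ‖p‖ = 1 := by
    have := congrArg norm hp
    rw [norm_pow, norm_neg, Complex.norm_conj, hτ] at this
    exact (pow_eq_one_iff_of_nonneg (norm_nonneg p) two_ne_zero).1 this
  have hpc := mul_conj_of_norm_eq_one hp1
  have hτc := mul_conj_of_norm_eq_one hτ
  have key : conj p = -(τ * p) := by
    linear_combination (τ * conj p) * hp - conj p * hτc - τ * p * hpc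
  have := norm_lt_norm_of_signedArea hα hf hinj hor (p := p) (q := -(η * p))
    (Or.inl (ne_zero_of_norm_eq_one hp1)) (fun i => by
      rw [map_neg, map_mul, key]
      linear_combination p * h i)
  rwa [norm_neg, norm_mul, hp1, mul_one] at this

theorem exists_interpolation {α f : Fin 3 → ℂ} (hα : ∀ i, ‖α i‖ = 1)
    (hf : ∀ i, ‖f i‖ = 1) (hinj : Function.Injective α)
    (hor : 0 < signedArea (α 0) (α 1) (α 2) * signedArea (f 0) (f 1) (f 2)) :
    ∃ η τ : ℂ, ‖τ‖ = 1 ∧ ∀ i, (α i - η) + τ * (1 - conj η * α i) * f i = 0 := by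
  obtain ⟨p, q, hpq, h⟩ := exists_moebius_interpolation hα hf
  have hlt := norm_lt_norm_of_signedArea hα hf hinj hor hpq h
  -- Orientation enters here: it excludes `p = 0`, where normalization by `p` would fail.
  have hp : p ≠ 0 := norm_pos_iff.1 ((norm_nonneg q).trans_lt hlt)
  have hpc : conj p ≠ 0 := (_root_.map_ne_zero _).2 hp
  refine ⟨-(q / p), -(conj p / p), ?_, fun i => ?_⟩
  · rw [norm_neg, norm_div, Complex.norm_conj, div_self (norm_ne_zero_iff.2 hp)]
  · rw [map_neg, map_div₀]
    field_simp
    linear_combination h i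

end OPUC

theorem theorem3p7 (μ : MeasureTheory.Measure ℂ) [MeasureTheory.IsFiniteMeasure μ]
    (hμT : μ (Metric.sphere (0 : ℂ) 1)ᶜ = 0) (hμ : μ.support.Infinite)
    (n : ℕ) (hn : 3 ≤ n)
    (α : Fin 3 → ℂ) (hαT : ∀ i, ‖α i‖ = 1) (hα : Function.Injective α)
    (f : Fin 3 → ℂ)
    (hf : ∀ i, f i = (starRingEnd ℂ) (OPUC.blaschke μ (n - 1) (α i)))
    (hf_inj : Function.Injective f)
    (hor : OPUC.SameOrientation (α 0) (α 1) (α 2) (f 0) (f 1) (f 2)) :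
    ∃ Q : Polynomial ℂ,
      (OPUC.IsQPOPUC μ n 1 Q ∧ Q.Monic ∧ OPUC.SimpleZerosOnCircle Q ∧ ∀ i, Q.IsRoot (α i)) ∧
      (∀ Q' : Polynomial ℂ,
        OPUC.IsQPOPUC μ n 1 Q' → Q'.Monic → OPUC.SimpleZerosOnCircle Q' →
          (∀ i, Q'.IsRoot (α i)) → Q' = Q) ∧
      ∃ η τ : ℂ, ‖η‖ < 1 ∧ ‖τ‖ = 1 ∧ Q = OPUC.q3 μ n η τ ∧
        ∀ η' τ' : ℂ, ‖τ'‖ = 1 → Q = OPUC.q3 μ n η' τ' → η' = η ∧ τ' = τ := by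
  obtain ⟨m, rfl⟩ := Nat.exists_eq_add_of_le' (show 2 ≤ n by omega)
  have hm : 1 ≤ m := by omega
  rw [show m + 2 - 1 = m + 1 by omega] at hf
  have hfT : ∀ i, ‖f i‖ = 1 := fun i => by
    rw [hf, Complex.norm_conj, OPUC.norm_blaschke hμT hμ m (hαT i)]
  have hpos := hor.signedArea_mul_pos
  have hroot : ∀ η τ i, (OPUC.q3 μ (m + 2) η τ).IsRoot (α i) ↔
      (α i - η) + τ * (1 - (starRingEnd ℂ) η * α i) * f i = 0 := fun η τ i => by
    rw [hf]
    exact OPUC.isRoot_q3_iff hμT hμ m (hαT i) η τ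
  obtain ⟨η, τ, hτ, h⟩ := OPUC.exists_interpolation hαT hfT hα hpos
  have hη := OPUC.norm_lt_one_of_interpolation hαT hfT hα hpos hτ h
  -- No bound on `η'` is assumed, so this yields both the uniqueness of `Q` and that of the pair in
  -- `ℂ × 𝕋`.
  have huniq : ∀ η' τ' : ℂ, ‖τ'‖ = 1 → (∀ i, (OPUC.q3 μ (m + 2) η' τ').IsRoot (α i)) →
      η' = η ∧ τ' = τ := fun η' τ' hτ' h' =>
    OPUC.moebius_parameters_unique hα hη hτ hτ' h fun i => (hroot η' τ' i).1 (h' i)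
  refine ⟨OPUC.q3 μ (m + 2) η τ, ⟨OPUC.isQPOPUC_q3 hμT hμ m η hτ, (OPUC.monic_q3 m η τ).1,
    OPUC.simpleZerosOnCircle_q3 hμT hμ m hη hτ, fun i => (hroot η τ i).2 (h i)⟩, ?_,
    η, τ, hη, hτ, rfl, ?_⟩
  · intro Q' hQ' hmonic _ hroots
    obtain ⟨η', τ', hτ', rfl⟩ := OPUC.exists_eq_q3 hμT hμ hm hQ' hmonic
    obtain ⟨rfl, rfl⟩ := huniq η' τ' hτ' hroots
    rfl
  · intro η' τ' hτ' heq
    exact huniq η' τ' hτ' fun i => heq ▸ (hroot η τ i).2 (h i)
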